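/- Let $x=(x_s)_{s\in\sigma}$ be a finite or infinite family of variables. For $m\ge 0$ let $h_m=h_m(x)$ be the complete homogeneous symmetric function of degree $m$ (the sum of all monomials of degree $m$ in the variables $x$, so that $h_0=1$), and put $h_m=0$ for $m<0$. For partitions $\lambda=(\lambda_1\ge\dots\ge\lambda_k\ge 0)$ and $\mu=(\mu_1\ge\dots\ge\mu_k\ge 0)$ with $\mu_p\le\lambda_p$ for all $p$, let $$s_{\lambda/\mu}=\det\bigl(h_{\lambda_p-\mu_q-p+q}\bigr)_{1\le p,q\le k},\qquad s_\lambda=s_{\lambda/(0,\dots,0)},$$ be the skew Schur function and the Schur function (trailing zeros may be added to or removed from $\lambda$ and $\mu$ without changing them). A symmetric function is called Schur-positive if it is a finite linear combination of Schur functions $s_\nu$ with non-negative integer coefficients. Then for every integer $i\ge 0$ the symmetric function $$s_{(i+3,\,i)/(1)}\,s_{(i+1)}-s_{(i+2,\,i+1)}\,s_{(i)}$$ is Schur-positive. -/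

import Mathlib

namespace SymmFun

/-- The complete homogeneous symmetric function `h_m` in the (finitely or infinitely many)
variables `x_s`, `s : σ`: the sum of all monomials of degree `m`, each taken once. -/
noncomputable def hfun (σ : Type*) (m : ℕ) : MvPowerSeries σ ℤ :=
  fun d => if d.degree = m then 1 else 0

/-- `h_k` for an integer index, with `h_k = 0` for `k < 0`. These are the entries of the infinite
Jacobi-Trudi matrix `H`, whose `(a, b)` entry is `h_{b - a}`. -/
noncomputable def hfunInt (σ : Type*) (k : ℤ) : MvPowerSeries σ ℤ :=
  if 0 ≤ k then hfun σ k.toNat else 0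

/-- The skew Schur function `s_{l/m}` of partitions `m ⊆ l`, given as weakly decreasing lists
(trailing zeros are allowed): the minor `det (h_{l_p - m_q - p + q})` of `H`, of size the length
of `l`, where `m` is padded by zeros. -/
noncomputable def skewSchur (σ : Type*) (l m : List ℕ) : MvPowerSeries σ ℤ :=
  (Matrix.of fun p q : Fin l.length =>
    hfunInt σ ((l.getD p 0 : ℤ) - (m.getD q 0 : ℤ) - (p : ℤ) + (q : ℤ))).det

/-- The Schur function `s_l = det (h_{l_p - p + q})`. -/
noncomputable def schur (σ : Type*) (l : List ℕ) : MvPowerSeries σ ℤ :=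
  skewSchur σ l []

/-- `f` is Schur-positive: it is a (finite) linear combination of Schur functions of partitions,
with non-negative integer coefficients. Partitions are represented by their Young diagrams;
`rowLens` is the list of the (positive) parts. -/
def SchurPositive {σ : Type*} (f : MvPowerSeries σ ℤ) : Prop :=
  ∃ c : YoungDiagram →₀ ℕ, f = c.sum fun ν n => n • schur σ ν.rowLens

end SymmFun

/-! Expanding the determinants turns the difference into `h_{i+3} h_i^2 - h_{i+4} h_{i+1} h_{i-2}`.
Adding and subtracting `h_{i+3} h_{i+1} h_{i-1}` and `h_{i+4} h_i h_{i-1}` rewrites this as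
`s_{(i,i)} h_{i+3} + s_{(i+3,i+1)} h_{i-1} + s_{(i,i-1)} h_{i+4}`, read in terms of two-row
determinants when `i = 0`. Each product expands by a Pieri rule (`sum_jacobiTrudi₃`) into three-row
determinants with possibly unsorted indices. In the outer two products all indices are partitions;
in the middle one the unsorted terms vanish or cancel (`SchurPositive.sum_jacobiTrudi₃_three`). -/

namespace SymmFun

open Finset

section JacobiTrudi

variable {R : Type*} [CommRing R] (H : ℤ → R)

/-- The three-row Jacobi-Trudi determinant, with arbitrary integer indices. -/
def jacobiTrudi₃ (p q r : ℤ) : R :=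
  H p * (H q * H r - H (q + 1) * H (r - 1))
    - H (p + 1) * (H (q - 1) * H r - H (q + 1) * H (r - 2))
    + H (p + 2) * (H (q - 1) * H (r - 1) - H q * H (r - 2))

/-- Straightening: the first two rows of the determinant are exchanged. -/
theorem jacobiTrudi₃_swap_left (p q r : ℤ) :
    jacobiTrudi₃ H (q - 1) (p + 1) r = -jacobiTrudi₃ H p q r := by
  simp only [jacobiTrudi₃, sub_add_cancel, add_sub_cancel_right,
    show q - 1 + 2 = q + 1 by ring, show p + 1 + 1 = p + 2 by ring]
  ring

theorem jacobiTrudi₃_eq_zero_of_left (p q r : ℤ) (h : q = p + 1) :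
    jacobiTrudi₃ H p q r = 0 := by
  subst h
  simp only [jacobiTrudi₃, add_sub_cancel_right, show p + 1 + 1 = p + 2 by ring]
  ring

/-- The first and third rows coincide. -/
theorem jacobiTrudi₃_eq_zero_of_outer (p q r : ℤ) (h : r = p + 2) :
    jacobiTrudi₃ H p q r = 0 := by
  subst h
  simp only [jacobiTrudi₃, add_sub_cancel_right, show p + 2 - 1 = p + 1 by ring]
  ring

/-- With `F c q = H (N - q - c) * H q * H c` and `q = b + j`, the summand is `F r q - F r (q - 1) +
F (r - 2) (q + 1) - F (r - 2) q - F (r - 1) (q + 1) + F (r - 1) (q - 1)`, which telescopes in `q`.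
-/
theorem sum_jacobiTrudi₃_middle (N b r : ℤ) (k : ℕ) :
    ∑ j ∈ range k, jacobiTrudi₃ H (N - (b + j) - r) (b + j) r =
      H (N - (b + k - 1) - r) * H (b + k - 1) * H r - H (N - (b - 1) - r) * H (b - 1) * H r
      + H (N - (b + k) - (r - 2)) * H (b + k) * H (r - 2) - H (N - b - (r - 2)) * H b * H (r - 2)
      - H (N - (b + k) - (r - 1)) * H (b + k) * H (r - 1)
      - H (N - (b + k - 1) - (r - 1)) * H (b + k - 1) * H (r - 1)
      + H (N - b - (r - 1)) * H b * H (r - 1)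
      + H (N - (b - 1) - (r - 1)) * H (b - 1) * H (r - 1) := by
  induction k with
  | zero => simp; ring
  | succ k ih =>
    rw [sum_range_succ, ih]
    simp only [jacobiTrudi₃]
    push_cast
    rw [show b + ((k : ℤ) + 1) - 1 = b + k by ring,
      show b + ((k : ℤ) + 1) = b + k + 1 by ring,
      show N - (b + (k : ℤ) - 1) - r = N - (b + k) - r + 1 by ring,
      show N - (b + (k : ℤ)) - (r - 2) = N - (b + k) - r + 2 by ring,
      show N - (b + (k : ℤ)) - (r - 1) = N - (b + k) - r + 1 by ring,
      show N - (b + (k : ℤ) - 1) - (r - 1) = N - (b + k) - r + 2 by ring,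
      show N - (b + (k : ℤ) + 1) - (r - 2) = N - (b + k) - r + 1 by ring,
      show N - (b + (k : ℤ) + 1) - (r - 1) = N - (b + k) - r by ring]
    ring

/-- A two-row Pieri rule, before straightening. -/
theorem sum_jacobiTrudi₃ (hH : ∀ k < 0, H k = 0) (N : ℤ) (m k : ℕ) :
    ∑ r ∈ range m, ∑ j ∈ range k,
        jacobiTrudi₃ H (N - ((m : ℤ) - 1 + j) - r) ((m : ℤ) - 1 + j) r =
      H (N - (m + k - 2) - (m - 1)) * (H (m + k - 2) * H (m - 1) - H (m + k - 1) * H (m - 2)) := by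
  have key (b : ℤ) (n : ℕ) : ∑ r ∈ range n, ∑ j ∈ range k,
        jacobiTrudi₃ H (N - (b + j) - r) (b + j) r =
      H (N - (b + k - 1) - (n - 1)) * H (b + k - 1) * H (n - 1)
      - H (N - (b - 1) - (n - 1)) * H (b - 1) * H (n - 1)
      - H (N - (b + k) - (n - 2)) * H (b + k) * H (n - 2)
      + H (N - b - (n - 2)) * H b * H (n - 2) := by
    induction n with
    -- Here the last factors are `H (-1)` and `H (-2)`, both zero.
    | zero => simp [hH]
    | succ n ih =>
      rw [sum_range_succ, ih, sum_jacobiTrudi₃_middle]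
      push_cast
      rw [show (n : ℤ) + 1 - 1 = n by ring, show (n : ℤ) + 1 - 2 = n - 1 by ring]
      ring
  -- For `b = m - 1` the two boundary terms free of `k` cancel.
  rw [key]
  rw [show (m : ℤ) - 1 + k - 1 = m + k - 2 by ring, show (m : ℤ) - 1 + k = m + k - 1 by ring,
    show (m : ℤ) - 1 - 1 = m - 2 by ring,
    show N - ((m : ℤ) + k - 1) - (m - 2) = N - (m + k - 2) - (m - 1) by ring,
    show N - ((m : ℤ) - 1) - (m - 2) = N - (m - 2) - (m - 1) by ring]
  ring

end JacobiTrudi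

variable {σ : Type*}

theorem SchurPositive.zero : SchurPositive (0 : MvPowerSeries σ ℤ) := ⟨0, by simp⟩

theorem SchurPositive.add {f g : MvPowerSeries σ ℤ} (hf : SchurPositive f)
    (hg : SchurPositive g) : SchurPositive (f + g) := by
  obtain ⟨c, rfl⟩ := hf
  obtain ⟨d, rfl⟩ := hg
  exact ⟨c + d, by rw [Finsupp.sum_add_index'] <;> simp [add_smul]⟩

theorem SchurPositive.sum {ι : Type*} {s : Finset ι} {f : ι → MvPowerSeries σ ℤ}
    (h : ∀ a ∈ s, SchurPositive (f a)) : SchurPositive (∑ a ∈ s, f a) :=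
  Finset.sum_induction f SchurPositive (fun _ _ => .add) .zero h

theorem SchurPositive.schur_of_sortedGE {w : List ℕ} (hw : w.SortedGE) (h : ∀ x ∈ w, 0 < x) :
    SchurPositive (schur σ w) :=
  ⟨Finsupp.single (YoungDiagram.ofRowLens w hw) 1, by
    rw [Finsupp.sum_single_index (by simp), YoungDiagram.rowLens_ofRowLens_eq_self (fun x hx => h x hx), one_smul]⟩

theorem hfunInt_of_neg {k : ℤ} (h : k < 0) : hfunInt σ k = 0 := by
  simp [hfunInt, h.not_ge]

theorem hfunInt_zero : hfunInt σ 0 = 1 := by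
  classical
  ext d
  simp only [hfunInt, le_refl, if_true, Int.toNat_zero, MvPowerSeries.coeff_one]
  change (if d.degree = 0 then (1 : ℤ) else 0) = _
  simp [Finsupp.degree_eq_zero_iff]

theorem jacobiTrudi₃_eq_schur (p q r : ℕ) :
    jacobiTrudi₃ (hfunInt σ) p q r = schur σ [p, q, r] := by
  simp only [schur, skewSchur, jacobiTrudi₃, List.length_cons, List.length_nil, Nat.reduceAdd]
  rw [Matrix.det_fin_three]
  simp
  ring_nf

theorem schur_pair_zero (p q : ℕ) : schur σ [p, q, 0] = schur σ [p, q] := by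
  rw [← jacobiTrudi₃_eq_schur]
  simp only [schur, skewSchur, jacobiTrudi₃, List.length_cons, List.length_nil, Nat.reduceAdd]
  rw [Matrix.det_fin_two]
  simp [hfunInt_zero, hfunInt_of_neg]

theorem schur_singleton (p : ℕ) : schur σ [p] = hfunInt σ p := by
  simp [schur, skewSchur]

theorem schur_singleton_zero (p : ℕ) : schur σ [p, 0] = schur σ [p] := by
  rw [schur_singleton]
  simp only [schur, skewSchur, List.length_cons, List.length_nil, Nat.reduceAdd]
  rw [Matrix.det_fin_two]
  simp [hfunInt_zero, hfunInt_of_neg]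

theorem SchurPositive.jacobiTrudi₃ {p q r : ℤ} (hpq : q ≤ p) (hqr : r ≤ q) (hr : 0 ≤ r) :
    SchurPositive (jacobiTrudi₃ (hfunInt σ) p q r) := by
  lift r to ℕ using hr
  lift q to ℕ using by omega
  lift p to ℕ using by omega
  rw [jacobiTrudi₃_eq_schur]
  norm_cast at hpq hqr
  rcases r.eq_zero_or_pos with rfl | hr
  · rw [schur_pair_zero]
    rcases q.eq_zero_or_pos with rfl | hq
    · rw [schur_singleton_zero]
      rcases p.eq_zero_or_pos with rfl | hp
      · rw [schur_singleton, Nat.cast_zero, hfunInt_zero,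
          show (1 : MvPowerSeries σ ℤ) = schur σ [] by simp [schur, skewSchur]]
        exact schur_of_sortedGE (by simp [List.sortedGE_iff_pairwise]) (by simp)
      · exact schur_of_sortedGE (by simp [List.sortedGE_iff_pairwise]) (by simpa)
    · exact schur_of_sortedGE (by simp [List.sortedGE_iff_pairwise]; omega) (by simp; omega)
  · exact schur_of_sortedGE (by simp [List.sortedGE_iff_pairwise]; omega) (by simp; omega)

/-- The part with third row `r` of the product `s_{(i+3,i+1)} h_{i-1}`. -/
theorem SchurPositive.sum_jacobiTrudi₃_three (i r : ℕ) (hr : r < i + 2) :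
    SchurPositive (∑ j ∈ range 3, SymmFun.jacobiTrudi₃ (hfunInt σ)
      (3 * i + 3 - (((i + 2 : ℕ) : ℤ) - 1 + j) - r) (((i + 2 : ℕ) : ℤ) - 1 + j) r) := by
  simp only [sum_range_succ, sum_range_zero, zero_add]
  push_cast
  rw [show (3 * i + 3 - ((i : ℤ) + 2 - 1 + 0) - r) = 2 * i + 2 - r by ring,
    show (3 * i + 3 - ((i : ℤ) + 2 - 1 + 1) - r) = 2 * i + 1 - r by ring,
    show (3 * i + 3 - ((i : ℤ) + 2 - 1 + 2) - r) = 2 * i - r by ring,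
    show ((i : ℤ) + 2 - 1 + 0) = i + 1 by ring, show ((i : ℤ) + 2 - 1 + 1) = i + 2 by ring,
    show ((i : ℤ) + 2 - 1 + 2) = i + 3 by ring]
  -- The last term has first index `2i - r` and second `i + 3`, so all three are sorted exactly when
  -- `r ≤ i - 3`; the other four values need straightening.
  obtain h | h | h | h | h : (r : ℤ) = i + 1 ∨ (r : ℤ) = i ∨ (r : ℤ) = i - 1 ∨ (r : ℤ) = i - 2 ∨
      (r : ℤ) ≤ i - 3 := by omega
  · have h₁ := jacobiTrudi₃_swap_left (hfunInt σ) (2 * i + 2 - r) (i + 1) r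
    rw [show (i : ℤ) + 1 - 1 = 2 * i + 1 - r by omega,
      show (2 * i + 2 - r : ℤ) + 1 = i + 2 by omega] at h₁
    rw [h₁, jacobiTrudi₃_eq_zero_of_outer _ (2 * i - r) _ _ (by omega), add_neg_cancel, add_zero]
    exact .zero
  · have h₁ := jacobiTrudi₃_swap_left (hfunInt σ) (2 * i + 2 - r) (i + 1) r
    rw [show (i : ℤ) + 1 - 1 = 2 * i - r by omega,
      show (2 * i + 2 - r : ℤ) + 1 = i + 3 by omega] at h₁
    rw [h₁, jacobiTrudi₃_eq_zero_of_left _ (2 * i + 1 - r) _ _ (by omega), add_zero,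
      add_neg_cancel]
    exact .zero
  · have h₁ := jacobiTrudi₃_swap_left (hfunInt σ) (2 * i + 1 - r) (i + 2) r
    rw [show (i : ℤ) + 2 - 1 = 2 * i - r by omega,
      show (2 * i + 1 - r : ℤ) + 1 = i + 3 by omega] at h₁
    rw [h₁, add_neg_cancel_right]
    exact .jacobiTrudi₃ (by omega) (by omega) (by omega)
  · rw [jacobiTrudi₃_eq_zero_of_left _ (2 * i - r) _ _ (by omega), add_zero]
    exact .add (.jacobiTrudi₃ (by omega) (by omega) (by omega))
      (.jacobiTrudi₃ (by omega) (by omega) (by omega))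
  · exact .add (.add (.jacobiTrudi₃ (by omega) (by omega) (by omega))
      (.jacobiTrudi₃ (by omega) (by omega) (by omega)))
      (.jacobiTrudi₃ (by omega) (by omega) (by omega))

/-- The difference of the two products in terms of the `h_k`. -/
theorem skewSchur_mul_sub_schur_mul (i : ℕ) :
    skewSchur σ [i + 3, i] [1] * schur σ [i + 1] - schur σ [i + 2, i + 1] * schur σ [i] =
      hfunInt σ (i + 3) * hfunInt σ i ^ 2
        - hfunInt σ (i + 4) * hfunInt σ (i + 1) * hfunInt σ (i - 2) := by
  have h₁ : skewSchur σ [i + 3, i] [1] =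
      hfunInt σ (i + 2) * hfunInt σ i - hfunInt σ (i + 4) * hfunInt σ (i - 2) := by
    simp only [skewSchur, List.length_cons, List.length_nil, Nat.reduceAdd]
    rw [Matrix.det_fin_two]
    simp
    ring_nf
  have h₂ : schur σ [i + 2, i + 1] =
      hfunInt σ (i + 2) * hfunInt σ (i + 1) - hfunInt σ (i + 3) * hfunInt σ i := by
    simp only [schur, skewSchur, List.length_cons, List.length_nil, Nat.reduceAdd]
    rw [Matrix.det_fin_two]
    simp
    ring_nf
    simp
  rw [h₁, h₂, schur_singleton, schur_singleton]
  push_cast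
  ring

end SymmFun

theorem mainTheorem3 (σ : Type*) (i : ℕ) :
    SymmFun.SchurPositive
      (SymmFun.skewSchur σ [i + 3, i] [1] * SymmFun.schur σ [i + 1]
        - SymmFun.schur σ [i + 2, i + 1] * SymmFun.schur σ [i]) := by
  open SymmFun Finset in
  have pieri := sum_jacobiTrudi₃ (hfunInt σ) (fun _ h => hfunInt_of_neg h) (3 * i + 3)
  -- The parameters `m`, `k` select the shape `(m + k - 2, m - 1)`: here `(i, i)`, then `(i + 3, i +
  -- 1)` and `(i, i - 1)`.
  have e₁ := pieri (i + 1) 1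
  have e₂ := pieri (i + 2) 3
  have e₃ := pieri i 2
  have p₁ : SchurPositive (∑ r ∈ range (i + 1), ∑ j ∈ range 1, jacobiTrudi₃ (hfunInt σ)
      (3 * i + 3 - (((i + 1 : ℕ) : ℤ) - 1 + j) - r) (((i + 1 : ℕ) : ℤ) - 1 + j) r) := by
    refine .sum fun r hr => .sum fun j hj => ?_
    rw [mem_range] at hr hj
    exact .jacobiTrudi₃ (by omega) (by omega) (by omega)
  have p₂ := SchurPositive.sum fun r hr =>
    SchurPositive.sum_jacobiTrudi₃_three (σ := σ) i r (mem_range.1 hr)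
  have p₃ : SchurPositive (∑ r ∈ range i, ∑ j ∈ range 2, jacobiTrudi₃ (hfunInt σ)
      (3 * i + 3 - ((i : ℤ) - 1 + j) - r) ((i : ℤ) - 1 + j) r) := by
    refine .sum fun r hr => .sum fun j hj => ?_
    rw [mem_range] at hr hj
    exact .jacobiTrudi₃ (by omega) (by omega) (by omega)
  rw [e₁] at p₁
  rw [e₂] at p₂
  rw [e₃] at p₃
  rw [skewSchur_mul_sub_schur_mul]
  -- The mixed products cancel between consecutive summands.
  convert (p₁.add p₂).add p₃ using 1
  push_cast
  ring_nf
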